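/- Let $p>3$ be a prime and let $$\Gamma_0(p)=\left\{\begin{pmatrix}a&b\\c&d\end{pmatrix}\in SL_2(\mathbb Z)\;:\;c\equiv 0 \pmod p\right\}.$$ Then the first group cohomology of $\Gamma_0(p)$ with coefficients in the trivial module $\mathbb Z$ is $$H^1(\Gamma_0(p),\mathbb Z)\cong \mathbb Z^{N(p)},$$ where $$N(p)=\begin{cases}(p-7)/6, & p\equiv 1 \pmod{12},\\ (p+1)/6, & p\equiv 5 \pmod{12},\\ (p-1)/6, & p\equiv 7 \pmod{12},\\ (p+7)/6, & p\equiv 11 \pmod{12}.\end{cases}$$ -/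

import Mathlib

/-- The rank `N(p)`, by the residue of `p` modulo 12. For a prime `p > 3` exactly one of the four
cases occurs, the subtractions do not truncate and the divisions by 6 are exact; the value `0`
outside these residue classes is never used. -/
def rankN (p : ℕ) : ℕ :=
  if p % 12 = 1 then (p - 7) / 6
  else if p % 12 = 5 then (p + 1) / 6
  else if p % 12 = 7 then (p - 1) / 6
  else if p % 12 = 11 then (p + 7) / 6
  else 0

/-! The coefficients are trivial, so `H^1` is `Hom(Γ₀(p), ℤ)`, which is finitely generated and
torsion-free; only its rank is needed. Write `G = SL(2, ℤ)` and `X = P¹(𝔽_p)`, on which `G` acts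
transitively with `Γ₀(p)` the stabilizer of `∞`. Shapiro's lemma identifies `Hom(Γ₀(p), ℤ)` with
crossed homomorphisms `G → ℤ^X` modulo coboundaries (`funCocyclesRestrict_surjective`,
`ker_funCocyclesRestrict`). Modulo `±1`, `G` is the free product of the groups of orders 2 and 3
generated by `S` and `U = T * S` (`SL2Z_exists_hom`, by ping-pong), so the crossed homomorphisms
form `ker(1 + S) × ker(1 + U + U²)` (`funCocyclesEquiv`). Burnside's lemma gives these kernels ranks
`(|X| - f₂)/2` and `2(|X| - f₃)/3`, where `f₂`, `f₃` count the fixed points of `S`, `U`. The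
coboundaries have rank `|X| - 1`, whence `6 · rank = |X| + 6 - 3 f₂ - 4 f₃`. Here `|X| = p + 1`, and
`f₂`, `f₃` are 0 or 2 according to whether `-1`, `-3` are squares mod `p`. -/

open Matrix.SpecialLinearGroup ModularGroup UpperHalfPlane
open scoped MatrixGroups

/-! ### The modular group modulo its centre as a free product. -/

/-- The homomorphism from the cyclic group of order `n` sending the generator to `h`. -/
noncomputable def cyclicHom {H : Type*} [Group H] (n : ℕ) (h : H) (hn : h ^ n = 1) :
    Multiplicative (ZMod n) →* H :=
  AddMonoidHom.toMultiplicativeLeft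
    (ZMod.lift n ⟨zmultiplesHom (Additive H) (Additive.ofMul h), by
      simp [← ofMul_pow, hn]⟩)

lemma cyclicHom_ofAdd_intCast {H : Type*} [Group H] (n : ℕ) (h : H) (hn : h ^ n = 1) (k : ℤ) :
    cyclicHom n h hn (Multiplicative.ofAdd (k : ZMod n)) = h ^ k := by
  simp [cyclicHom]

lemma cyclicHom_ofAdd_one {H : Type*} [Group H] (n : ℕ) (h : H) (hn : h ^ n = 1) :
    cyclicHom n h hn (Multiplicative.ofAdd 1) = h := by
  simpa using cyclicHom_ofAdd_intCast n h hn 1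

/-- A subgroup of `SL(2, ℤ)` containing `S` and `T * S` is everything. -/
lemma SL2Z_mem_of_S_of_TS (K : Subgroup SL(2, ℤ)) (hS : S ∈ K) (hU : T * S ∈ K) (g : SL(2, ℤ)) :
    g ∈ K := by
  have hT : T ∈ K := by simpa using K.mul_mem hU (K.inv_mem hS)
  have : Subgroup.closure {S, T} ≤ K := by
    rw [Subgroup.closure_le]
    rintro x (rfl | rfl) <;> assumption
  exact this (by simp [SpecialLinearGroup.SL2Z_generators])

lemma S_mul_S : S * S = (-1 : SL(2, ℤ)) := by
  apply Subtype.ext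
  decide

lemma TS_pow_three : (T * S) ^ 3 = (-1 : SL(2, ℤ)) := by
  apply Subtype.ext
  decide

lemma re_S_smul (z : ℍ) : (S • z).re = - z.re / Complex.normSq z := by
  rw [modular_S_smul]
  change ((-(z : ℂ))⁻¹).re = _
  rw [Complex.inv_re, Complex.normSq_neg]
  rfl

lemma re_TS_smul (z : ℍ) : ((T * S) • z).re = 1 - z.re / Complex.normSq z := by
  rw [mul_smul, modular_T_smul, vadd_re, re_S_smul]
  ring

/-- As `(T * S) ^ 3 = -1` acts trivially, the square acts as the inverse `z ↦ -1 / (z - 1)`. -/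
lemma re_TS_sq_smul_pos {z : ℍ} (hz : z.re < 0) : 0 < ((T * S) • (T * S) • z).re := by
  have h : ((T * S) • (T * S) • z) = (T * S)⁻¹ • z := by
    rw [eq_inv_smul_iff, ← mul_smul, ← mul_smul, ← pow_two, ← pow_succ, TS_pow_three, SL_neg_smul,
      one_smul]
  rw [h, mul_inv_rev, mul_smul]
  have h1 : (S⁻¹ : SL(2, ℤ)) = -S := by
    rw [inv_eq_iff_mul_eq_one]; simp [S_mul_S]
  have h2 : (T⁻¹ • z).re = z.re - 1 := by
    have := congrArg UpperHalfPlane.re (modular_T_zpow_smul z (-1))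
    rw [zpow_neg_one, vadd_re] at this
    rw [this]; push_cast; ring
  rw [h1, SL_neg_smul, re_S_smul, h2]
  have := Complex.normSq_pos.mpr (ne_zero (T⁻¹ • z))
  apply div_pos _ this
  linarith

/-- The modular group is the free product of cyclic groups of orders two and three:
homomorphisms out of it may be prescribed on `S` and `T * S`. -/
theorem SL2Z_exists_hom {H : Type*} [Group H] (s u : H) (hs : s ^ 2 = 1) (hu : u ^ 3 = 1) :
    ∃ F : SL(2, ℤ) →* H, F S = s ∧ F (T * S) = u := by
  let ρ : SL(2, ℤ) →* Equiv.Perm ℍ := MulAction.toPermHom SL(2, ℤ) ℍ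
  have hneg : ρ (-1) = 1 := by
    ext1 z
    change (-1 : SL(2, ℤ)) • z = z
    rw [SL_neg_smul, one_smul]
  let n : Bool → ℕ := fun b => cond b 3 2
  let v : Bool → Equiv.Perm ℍ := fun b => cond b (ρ (T * S)) (ρ S)
  let w : Bool → H := fun b => cond b u s
  have hv : ∀ b, v b ^ n b = 1 := by
    rintro (_ | _)
    · change ρ S ^ 2 = 1
      rw [← map_pow, pow_two, S_mul_S, hneg]
    · change ρ (T * S) ^ 3 = 1
      rw [← map_pow, TS_pow_three, hneg]
  have hw : ∀ b, w b ^ n b = 1 := by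
    rintro (_ | _)
    · exact hs
    · exact hu
  let f : ∀ b, Multiplicative (ZMod (n b)) →* Equiv.Perm ℍ := fun b => cyclicHom (n b) (v b) (hv b)
  -- Ping-pong table: `S` maps `Re > 0` into `Re < 0`, and both nontrivial powers of `T * S` map `Re
  -- < 0` into `Re > 0`.
  let Y : Bool → Set ℍ := fun b => cond b {z | 0 < z.re} {z | z.re < 0}
  have hL : Function.Injective (Monoid.CoprodI.lift f) := by
    -- With only two factors, ping-pong needs one of order at least 3.
    refine Monoid.CoprodI.lift_injective_of_ping_pong f (Or.inr ⟨true, ?_⟩) Y ?_ ?_ ?_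
    · change 3 ≤ Cardinal.mk (ZMod 3)
      simp
    · rintro (_ | _)
      · exact ⟨⟨⟨-1, 1⟩, one_pos⟩, show (-1 : ℝ) < 0 by norm_num⟩
      · exact ⟨⟨⟨1, 1⟩, one_pos⟩, show (0 : ℝ) < 1 by norm_num⟩
    · rintro (_ | _) (_ | _) hij
      · exact absurd rfl hij
      · exact Set.disjoint_left.mpr fun z hz hz' => lt_asymm (a := z.re) hz hz'
      · exact Set.disjoint_left.mpr fun z hz hz' => lt_asymm (a := z.re) hz' hz
      · exact absurd rfl hij
    · rintro (_ | _) (_ | _) hij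
      · exact absurd rfl hij
      · intro h hh
        have key : f false h = ρ S := by
          revert h
          change ∀ h : ZMod 2, h ≠ 0 → cyclicHom 2 (v false) (hv false) (Multiplicative.ofAdd h) = _
          intro h hh
          have : h = 1 := by revert h; decide
          rw [this, cyclicHom_ofAdd_one]; rfl
        rw [key]
        rintro _ ⟨z, hz, rfl⟩
        change 0 < z.re at hz
        change (S • z).re < 0
        rw [re_S_smul]
        exact div_neg_of_neg_of_pos (by linarith) (Complex.normSq_pos.mpr (ne_zero z))
      · intro h hh
        have key : f true h = ρ (T * S) ∨ f true h = ρ (T * S) * ρ (T * S) := by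
          revert h
          change ∀ h : ZMod 3, h ≠ 0 → cyclicHom 3 (v true) (hv true) (Multiplicative.ofAdd h) = _ ∨
            cyclicHom 3 (v true) (hv true) (Multiplicative.ofAdd h) = _
          intro h hh
          have : h = 1 ∨ h = ((2 : ℤ) : ZMod 3) := by revert h; decide
          rcases this with rfl | rfl
          · left; rw [cyclicHom_ofAdd_one]; rfl
          · right; rw [cyclicHom_ofAdd_intCast, zpow_two]; rfl
        rintro _ ⟨z, hz, rfl⟩
        change z.re < 0 at hz
        rcases key with key | key
        · rw [key]
          change 0 < ((T * S) • z).re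
          rw [re_TS_smul]
          have := div_neg_of_neg_of_pos hz (Complex.normSq_pos.mpr (ne_zero z))
          linarith
        · rw [key]
          exact re_TS_sq_smul_pos hz
      · exact absurd rfl hij
  have hof : ∀ b, Monoid.CoprodI.lift f
      (Monoid.CoprodI.of (i := b) (Multiplicative.ofAdd (1 : ZMod (n b)))) = v b := fun b => by
    rw [Monoid.CoprodI.lift_of]
    exact cyclicHom_ofAdd_one _ _ _
  -- The image of `ρ` lies in the embedded free product, so `ρ` factors through it and the universal
  -- property applies.
  have hrange : ∀ g, ρ g ∈ (Monoid.CoprodI.lift f).range := fun g =>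
    SL2Z_mem_of_S_of_TS ((Monoid.CoprodI.lift f).range.comap ρ) ⟨_, hof false⟩ ⟨_, hof true⟩ g
  let e := MonoidHom.ofInjective hL
  let F : SL(2, ℤ) →* H :=
    (Monoid.CoprodI.lift fun b => cyclicHom (n b) (w b) (hw b)).comp
      (e.symm.toMonoidHom.comp (ρ.codRestrict _ hrange))
  have hF : ∀ b g, ρ g = v b → F g = w b := by
    intro b g hg
    have h1 : e.symm (ρ.codRestrict _ hrange g) =
        Monoid.CoprodI.of (i := b) (Multiplicative.ofAdd (1 : ZMod (n b))) := by
      rw [MulEquiv.symm_apply_eq]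
      ext1
      exact hg.trans (hof b).symm
    change Monoid.CoprodI.lift (fun b => cyclicHom (n b) (w b) (hw b))
      (e.symm (ρ.codRestrict _ hrange g)) = _
    rw [h1, Monoid.CoprodI.lift_of]
    exact cyclicHom_ofAdd_one _ _ _
  exact ⟨F, hF false S rfl, hF true (T * S) rfl⟩

/-! ### Ranks of kernels of norm maps on permutation modules. -/

lemma LinearMap.finrank_range_add_finrank_ker_int {M N : Type*} [AddCommGroup M] [Module.Finite ℤ M]
    [AddCommGroup N] (f : M →ₗ[ℤ] N) :
    Module.finrank ℤ (LinearMap.range f) + Module.finrank ℤ (LinearMap.ker f) =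
      Module.finrank ℤ M := by
  rw [← f.quotKerEquivRange.finrank_eq, Submodule.finrank_quotient_add_finrank]

/-- The sum of the translates of a function by a finite group. -/
def sumTranslates (A X : Type*) [Group A] [Fintype A] [MulAction A X] :
    (X → ℤ) →ₗ[ℤ] (X → ℤ) :=
  ∑ g : A, LinearMap.funLeft ℤ ℤ (fun x : X => g • x)

lemma sumTranslates_apply {A X : Type*} [Group A] [Fintype A] [MulAction A X] (f : X → ℤ) (x : X) :
    sumTranslates A X f x = ∑ g : A, f (g • x) := by
  simp [sumTranslates, LinearMap.funLeft_apply]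

/-- The image lies in the orbit-constant functions and contains `|A|` times each of them, so the
ranks agree. -/
lemma finrank_range_sumTranslates (A X : Type*) [Group A] [Fintype A] [Fintype X] [MulAction A X] :
    Module.finrank ℤ (LinearMap.range (sumTranslates A X)) =
      Nat.card (MulAction.orbitRel.Quotient A X) := by
  classical
  let π : X → MulAction.orbitRel.Quotient A X := Quotient.mk _
  let q : (MulAction.orbitRel.Quotient A X → ℤ) →ₗ[ℤ] (X → ℤ) :=
    LinearMap.funLeft ℤ ℤ π
  have hq : Function.Injective q :=
    LinearMap.funLeft_injective_of_surjective _ _ _ Quotient.mk_surjective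
  have hqr : Module.finrank ℤ (LinearMap.range q) =
      Nat.card (MulAction.orbitRel.Quotient A X) := by
    rw [LinearMap.finrank_range_of_inj hq, Module.finrank_fintype_fun_eq_card,
      Nat.card_eq_fintype_card]
  rw [← hqr]
  apply le_antisymm
  · apply Submodule.finrank_mono
    rintro _ ⟨f, rfl⟩
    refine ⟨fun o => Quotient.liftOn o (sumTranslates A X f) ?_, ?_⟩
    · rintro _ y ⟨g, rfl⟩
      simp only [sumTranslates_apply, ← mul_smul]
      exact Fintype.sum_equiv (Equiv.mulRight g) _ _ fun _ => rfl
    · rfl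
  · have hn : ((Fintype.card A : ℤ)) ≠ 0 := by simp
    let m : (MulAction.orbitRel.Quotient A X → ℤ) →ₗ[ℤ] (X → ℤ) := (sumTranslates A X).comp q
    have hm : ∀ f, m f = (Fintype.card A : ℤ) • q f := by
      intro f
      ext x
      have : ∀ g : A, q f (g • x) = q f x := fun g =>
        congrArg f (Quotient.sound ⟨g, rfl⟩)
      simp [m, sumTranslates_apply, this]
    have hmi : Function.Injective m := by
      intro f f' h
      rw [hm, hm] at h
      exact hq (smul_right_injective _ hn h)
    rw [LinearMap.finrank_range_of_inj hq, ← LinearMap.finrank_range_of_inj hmi]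
    exact Submodule.finrank_mono (LinearMap.range_comp_le_range _ _)

/-- Rank-nullity combined with Burnside's orbit count. -/
lemma card_mul_finrank_ker_sumTranslates (A X : Type*) [Group A] [Fintype A] [Fintype X]
    [MulAction A X] :
    Fintype.card A * Module.finrank ℤ (LinearMap.ker (sumTranslates A X)) +
      ∑ g : A, Nat.card (MulAction.fixedBy X g) = Fintype.card A * Fintype.card X := by
  classical
  have h1 := MulAction.sum_card_fixedBy_eq_card_orbits_mul_card_group A X
  have h2 := LinearMap.finrank_range_add_finrank_ker_int (sumTranslates A X)
  rw [finrank_range_sumTranslates, Module.finrank_fintype_fun_eq_card] at h2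
  simp only [Nat.card_eq_fintype_card] at h2 ⊢
  rw [h1, ← h2]
  ring

lemma two_mul_finrank_ker_add {X : Type*} [Fintype X] (σ : Equiv.Perm X) (hσ : σ ^ 2 = 1) :
    2 * Module.finrank ℤ
      (LinearMap.ker (LinearMap.id + LinearMap.funLeft ℤ ℤ σ : (X → ℤ) →ₗ[ℤ] (X → ℤ))) +
      Nat.card {x // σ x = x} = Fintype.card X := by
  let : MulAction (Multiplicative (ZMod 2)) X := MulAction.compHom X (cyclicHom 2 σ hσ)
  have h0 : ∀ x : X, (Multiplicative.ofAdd (0 : ZMod 2)) • x = x := fun x => one_smul _ x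
  have h1 : ∀ x : X, (Multiplicative.ofAdd (1 : ZMod 2)) • x = σ x := fun x =>
    congrArg (fun τ : Equiv.Perm X => τ x) (cyclicHom_ofAdd_one 2 σ hσ)
  have hsum : ∀ {M : Type} [AddCommMonoid M] (F : Multiplicative (ZMod 2) → M),
      ∑ g, F g = F (Multiplicative.ofAdd 0) + F (Multiplicative.ofAdd 1) := fun F =>
    Fin.sum_univ_two (fun i : ZMod 2 => F (Multiplicative.ofAdd i))
  have hN : sumTranslates (Multiplicative (ZMod 2)) X =
      LinearMap.id + LinearMap.funLeft ℤ ℤ σ := by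
    ext1 f; ext x
    rw [sumTranslates_apply, hsum, h0, h1]; rfl
  have h := card_mul_finrank_ker_sumTranslates (Multiplicative (ZMod 2)) X
  rw [hN, hsum] at h
  have hf0 : Nat.card (MulAction.fixedBy X (Multiplicative.ofAdd (0 : ZMod 2))) =
      Fintype.card X := by
    rw [← Nat.card_eq_fintype_card]
    exact Nat.card_congr (Equiv.subtypeUnivEquiv h0)
  have hf1 : Nat.card (MulAction.fixedBy X (Multiplicative.ofAdd (1 : ZMod 2))) =
      Nat.card {x // σ x = x} :=
    Nat.card_congr (Equiv.subtypeEquivRight fun x => by rw [MulAction.mem_fixedBy, h1])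
  have hc : Fintype.card (Multiplicative (ZMod 2)) = 2 := ZMod.card 2
  rw [hf0, hf1, hc] at h
  omega

lemma three_mul_finrank_ker_add {X : Type*} [Fintype X] (σ : Equiv.Perm X) (hσ : σ ^ 3 = 1) :
    3 * Module.finrank ℤ
      (LinearMap.ker (LinearMap.id + LinearMap.funLeft ℤ ℤ σ +
        LinearMap.funLeft ℤ ℤ (σ * σ) : (X → ℤ) →ₗ[ℤ] (X → ℤ))) +
      2 * Nat.card {x // σ x = x} = 2 * Fintype.card X := by
  let : MulAction (Multiplicative (ZMod 3)) X := MulAction.compHom X (cyclicHom 3 σ hσ)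
  have h0 : ∀ x : X, (Multiplicative.ofAdd (0 : ZMod 3)) • x = x := fun x => one_smul _ x
  have h1 : ∀ x : X, (Multiplicative.ofAdd (1 : ZMod 3)) • x = σ x := fun x =>
    congrArg (fun τ : Equiv.Perm X => τ x) (cyclicHom_ofAdd_one 3 σ hσ)
  have h2 : ∀ x : X, (Multiplicative.ofAdd (2 : ZMod 3)) • x = (σ * σ) x := fun x =>
    (congrArg (fun τ : Equiv.Perm X => τ x) (cyclicHom_ofAdd_intCast 3 σ hσ 2)).trans
      (by rw [zpow_two])
  have hsum : ∀ {M : Type} [AddCommMonoid M] (F : Multiplicative (ZMod 3) → M),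
      ∑ g, F g = F (Multiplicative.ofAdd 0) + F (Multiplicative.ofAdd 1) +
        F (Multiplicative.ofAdd 2) := fun F =>
    Fin.sum_univ_three (fun i : ZMod 3 => F (Multiplicative.ofAdd i))
  have hN : sumTranslates (Multiplicative (ZMod 3)) X =
      LinearMap.id + LinearMap.funLeft ℤ ℤ σ + LinearMap.funLeft ℤ ℤ (σ * σ) := by
    ext1 f; ext x
    rw [sumTranslates_apply, hsum, h0, h1, h2]; rfl
  have h := card_mul_finrank_ker_sumTranslates (Multiplicative (ZMod 3)) X
  rw [hN, hsum] at h
  have hf0 : Nat.card (MulAction.fixedBy X (Multiplicative.ofAdd (0 : ZMod 3))) =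
      Fintype.card X := by
    rw [← Nat.card_eq_fintype_card]
    exact Nat.card_congr (Equiv.subtypeUnivEquiv h0)
  have hf1 : Nat.card (MulAction.fixedBy X (Multiplicative.ofAdd (1 : ZMod 3))) =
      Nat.card {x // σ x = x} :=
    Nat.card_congr (Equiv.subtypeEquivRight fun x => by rw [MulAction.mem_fixedBy, h1])
  have hf2 : Nat.card (MulAction.fixedBy X (Multiplicative.ofAdd (2 : ZMod 3))) =
      Nat.card {x // σ x = x} :=
    Nat.card_congr (Equiv.subtypeEquivRight fun x => by
      rw [MulAction.mem_fixedBy, h2]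
      -- If `σ² x = x`, then `σ³ x = x` reads `σ x = x`.
      refine ⟨fun hx => ?_, fun hx => by simp [hx]⟩
      have h3 : σ (σ (σ x)) = x := congrArg (fun τ : Equiv.Perm X => τ x) hσ
      rw [Equiv.Perm.mul_apply] at hx
      rwa [hx] at h3)
  have hc : Fintype.card (Multiplicative (ZMod 3)) = 3 := ZMod.card 3
  rw [hf0, hf1, hf2, hc] at h
  omega

/-! ### Shapiro's lemma in degree one, by explicit cocycles. -/

section Shapiro

variable (G X : Type*) [Group G] [MulAction G X]

/-- The crossed homomorphisms from `G` to the permutation module of functions on `X`. -/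
def funCocycles : Submodule ℤ (G → X → ℤ) where
  carrier := {c | ∀ g h x, c (g * h) x = c g (h • x) + c h x}
  add_mem' := by
    intro c d hc hd g h x
    simp only [Pi.add_apply, hc g h x, hd g h x]; ring
  zero_mem' := by intro g h x; simp
  smul_mem' := by
    intro k c hc g h x
    simp only [Pi.smul_apply, hc g h x, smul_add]

variable {G X}

lemma funCocycles_one (c : funCocycles G X) (x : X) : c.1 1 x = 0 := by
  have := c.2 1 1 x
  simpa using this

variable (G X) in
/-- The crossed homomorphism `(g, x) ↦ f (g • x) - f x`. -/
def funCoboundary : (X → ℤ) →ₗ[ℤ] funCocycles G X where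
  toFun f := ⟨fun g x => f (g • x) - f x, fun g h x => by simp only [mul_smul]; ring⟩
  map_add' f f' := by ext g x; simp; ring
  map_smul' k f := by ext g x; simp; ring

/-- Restriction of a crossed homomorphism to a subgroup fixing a point. -/
def funCocyclesRestrict (Γ : Subgroup G) (x₀ : X) (hΓ : ∀ g, g ∈ Γ ↔ g • x₀ = x₀) :
    funCocycles G X →ₗ[ℤ] (Additive Γ →+ ℤ) where
  toFun c :=
    { toFun := fun γ => c.1 γ.toMul.1 x₀
      map_zero' := funCocycles_one c x₀
      map_add' := fun γ δ => by
        have := c.2 γ.toMul.1 δ.toMul.1 x₀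
        rw [(hΓ _).1 δ.toMul.2] at this
        exact this }
  map_add' c d := rfl
  map_smul' k c := rfl

lemma funCocyclesRestrict_apply (Γ : Subgroup G) (x₀ : X) (hΓ : ∀ g, g ∈ Γ ↔ g • x₀ = x₀)
    (c : funCocycles G X) (γ : Γ) :
    funCocyclesRestrict Γ x₀ hΓ c (Additive.ofMul γ) = c.1 γ.1 x₀ := rfl

variable [MulAction.IsPretransitive G X]

/-- With `s x` carrying `x₀` to `x`, the cocycle `φ((s (g • x))⁻¹ g (s x))` restricts to `φ` up to
conjugation by `s x₀ ∈ Γ`, invisible in the commutative group `ℤ`. -/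
lemma funCocyclesRestrict_surjective (Γ : Subgroup G) (x₀ : X)
    (hΓ : ∀ g, g ∈ Γ ↔ g • x₀ = x₀) :
    Function.Surjective (funCocyclesRestrict Γ x₀ hΓ) := by
  intro φ
  choose s hs using MulAction.exists_smul_eq G x₀
  have hmem : ∀ g x, (s (g • x))⁻¹ * g * s x ∈ Γ := fun g x => by
    rw [hΓ, mul_smul, mul_smul, hs, inv_smul_eq_iff, hs]
  have hadd : ∀ γ δ : Γ, φ (Additive.ofMul (γ * δ)) =
      φ (Additive.ofMul γ) + φ (Additive.ofMul δ) := fun γ δ => map_add φ _ _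
  have hs₀ : s x₀ ∈ Γ := by rw [hΓ, hs]
  let c : funCocycles G X := ⟨fun g x => φ (Additive.ofMul ⟨_, hmem g x⟩), fun g h x => by
    rw [← hadd]
    refine congrArg (fun γ => φ (Additive.ofMul γ)) (Subtype.ext ?_)
    simp only [mul_smul, Subgroup.coe_mul]
    group⟩
  refine ⟨c, ?_⟩
  refine AddMonoidHom.ext fun γ' => ?_
  obtain ⟨γ, rfl⟩ := Additive.ofMul.surjective γ'
  rw [funCocyclesRestrict_apply]
  have h1 : (⟨_, hmem γ.1 x₀⟩ : Γ) = ⟨s x₀, hs₀⟩⁻¹ * γ * ⟨s x₀, hs₀⟩ := by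
    ext1
    simp only [(hΓ _).1 γ.2]
    rfl
  change φ (Additive.ofMul ⟨_, hmem γ.1 x₀⟩) = _
  rw [h1, hadd, hadd, ofMul_inv, map_neg]
  ring

lemma ker_funCocyclesRestrict (Γ : Subgroup G) (x₀ : X)
    (hΓ : ∀ g, g ∈ Γ ↔ g • x₀ = x₀) :
    LinearMap.ker (funCocyclesRestrict Γ x₀ hΓ) = LinearMap.range (funCoboundary G X) := by
  apply le_antisymm
  · intro c hc
    have hc' : ∀ γ ∈ Γ, c.1 γ x₀ = 0 := fun γ hγ =>
      DFunLike.congr_fun (LinearMap.mem_ker.1 hc) (Additive.ofMul ⟨γ, hγ⟩)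
    choose s hs using MulAction.exists_smul_eq G x₀
    -- Two choices of `s x` differ by an element of `Γ`, where `c` vanishes at `x₀`, so this
    -- primitive does not depend on the choice.
    refine ⟨fun x => c.1 (s x) x₀, ?_⟩
    ext g x
    change c.1 (s (g • x)) x₀ - c.1 (s x) x₀ = c.1 g x
    have hmem : (s (g • x))⁻¹ * (g * s x) ∈ Γ := by
      rw [hΓ, mul_smul, mul_smul, hs, inv_smul_eq_iff, hs]
    have h1 := c.2 g (s x) x₀
    have h2 := c.2 (s (g • x)) ((s (g • x))⁻¹ * (g * s x)) x₀
    rw [hc' _ hmem, (hΓ _).1 hmem, mul_inv_cancel_left] at h2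
    rw [hs] at h1
    linarith
  · rintro _ ⟨f, rfl⟩
    refine AddMonoidHom.ext fun γ' => ?_
    obtain ⟨γ, rfl⟩ := Additive.ofMul.surjective γ'
    rw [funCocyclesRestrict_apply]
    change f (γ.1 • x₀) - f x₀ = 0
    rw [(hΓ _).1 γ.2, sub_self]

/-- By transitivity the kernel is the constants, of rank one. -/
lemma finrank_range_funCoboundary [Fintype X] [Nonempty X] :
    Module.finrank ℤ (LinearMap.range (funCoboundary G X)) + 1 = Fintype.card X := by
  have h := LinearMap.finrank_range_add_finrank_ker_int (funCoboundary G X)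
  rw [Module.finrank_fintype_fun_eq_card] at h
  let k : ℤ →ₗ[ℤ] (X → ℤ) := LinearMap.pi fun _ => LinearMap.id
  have hk : Function.Injective k := fun a b hab => congrFun hab (Classical.arbitrary X)
  have hker : LinearMap.ker (funCoboundary G X) = LinearMap.range k := by
    apply le_antisymm
    · intro f hf
      refine ⟨f (Classical.arbitrary X), ?_⟩
      ext x
      obtain ⟨g, hg⟩ := MulAction.exists_smul_eq G x (Classical.arbitrary X)
      have h1 : f (g • x) - f x = 0 := congrFun (congrFun (congrArg Subtype.val hf) g) x
      rw [hg] at h1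
      exact sub_eq_zero.1 h1
    · rintro _ ⟨a, rfl⟩
      ext g x
      exact sub_self a
  rw [hker, LinearMap.finrank_range_of_inj hk, Module.finrank_self] at h
  exact h

lemma finrank_hom_add_card [Fintype X] [Module.Finite ℤ (funCocycles G X)] (Γ : Subgroup G)
    (x₀ : X) (hΓ : ∀ g, g ∈ Γ ↔ g • x₀ = x₀) :
    Module.finrank ℤ (Additive Γ →+ ℤ) + Fintype.card X =
      Module.finrank ℤ (funCocycles G X) + 1 := by
  have : Nonempty X := ⟨x₀⟩
  have h := LinearMap.finrank_range_add_finrank_ker_int (funCocyclesRestrict Γ x₀ hΓ)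
  rw [ker_funCocyclesRestrict, LinearMap.range_eq_top.2 (funCocyclesRestrict_surjective Γ x₀ hΓ),
    finrank_top] at h
  have h2 := finrank_range_funCoboundary (G := G) (X := X)
  omega

end Shapiro

/-! ### Crossed homomorphisms on the modular group. -/

section Modular

variable {X : Type*} [MulAction SL(2, ℤ) X]

/-- The permutation of `X × ℤ` lifting a permutation `σ` of `X` with translation part `a`. -/
def skewPerm {X : Type*} (σ : Equiv.Perm X) (a : X → ℤ) : Equiv.Perm (X × ℤ) where
  toFun y := (σ y.1, y.2 + a y.1)
  invFun y := (σ.symm y.1, y.2 - a (σ.symm y.1))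
  left_inv y := by simp
  right_inv y := by simp

lemma skewPerm_apply {X : Type*} (σ : Equiv.Perm X) (a : X → ℤ) (x : X) (n : ℤ) :
    skewPerm σ a (x, n) = (σ x, n + a x) := rfl

/-- Twice this value is the value at `1`, and `ℤ` has no 2-torsion. -/
lemma funCocycles_neg_one (hneg : ∀ x : X, (-1 : SL(2, ℤ)) • x = x)
    (c : funCocycles SL(2, ℤ) X) (x : X) : c.1 (-1) x = 0 := by
  have h := c.2 (-1) (-1) x
  rw [hneg, neg_one_mul, neg_neg, funCocycles_one] at h
  omega

variable (X) in
/-- The norm-type map attached to `S`. -/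
def normS : (X → ℤ) →ₗ[ℤ] (X → ℤ) :=
  LinearMap.id + LinearMap.funLeft ℤ ℤ (MulAction.toPermHom SL(2, ℤ) X S)

variable (X) in
/-- The norm-type map attached to `T * S`. -/
def normTS : (X → ℤ) →ₗ[ℤ] (X → ℤ) :=
  LinearMap.id + LinearMap.funLeft ℤ ℤ (MulAction.toPermHom SL(2, ℤ) X (T * S)) +
    LinearMap.funLeft ℤ ℤ
      (MulAction.toPermHom SL(2, ℤ) X (T * S) * MulAction.toPermHom SL(2, ℤ) X (T * S))

lemma mem_ker_normS (f : X → ℤ) : f ∈ LinearMap.ker (normS X) ↔ ∀ x, f x + f (S • x) = 0 := by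
  rw [LinearMap.mem_ker, funext_iff]; rfl

lemma mem_ker_normTS (f : X → ℤ) : f ∈ LinearMap.ker (normTS X) ↔
    ∀ x, f x + f ((T * S) • x) + f ((T * S) • (T * S) • x) = 0 := by
  rw [LinearMap.mem_ker, funext_iff]; rfl

/-- A crossed homomorphism on the modular group evaluated at the two generators. -/
def evalGenerators (hneg : ∀ x : X, (-1 : SL(2, ℤ)) • x = x) :
    funCocycles SL(2, ℤ) X →ₗ[ℤ] LinearMap.ker (normS X) × LinearMap.ker (normTS X) where
  toFun c := (⟨c.1 S, by
      rw [mem_ker_normS]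
      intro x
      have h := c.2 S S x
      rw [S_mul_S, funCocycles_neg_one hneg] at h
      omega⟩,
    ⟨c.1 (T * S), by
      rw [mem_ker_normTS]
      intro x
      have h := c.2 (T * S) ((T * S) * (T * S)) x
      rw [c.2 (T * S) (T * S) x, ← pow_two, ← pow_succ', TS_pow_three, funCocycles_neg_one hneg,
        pow_two, mul_smul] at h
      omega⟩)
  map_add' c d := rfl
  map_smul' k c := rfl

lemma evalGenerators_injective (hneg : ∀ x : X, (-1 : SL(2, ℤ)) • x = x) :
    Function.Injective (evalGenerators hneg) := by
  rw [← LinearMap.ker_eq_bot, LinearMap.ker_eq_bot']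
  intro c hc
  have hS : c.1 S = 0 := congrArg (fun y => y.1.1) hc
  have hU : c.1 (T * S) = 0 := congrArg (fun y => y.2.1) hc
  let K : Subgroup SL(2, ℤ) :=
    { carrier := {g | ∀ x, c.1 g x = 0}
      mul_mem' := fun {a b} ha hb x => by rw [c.2, ha, hb, add_zero]
      one_mem' := funCocycles_one c
      inv_mem' := fun {a} ha x => by
        have h := c.2 a a⁻¹ x
        rwa [mul_inv_cancel, funCocycles_one, ha, zero_add, eq_comm] at h }
  ext g x
  exact SL2Z_mem_of_S_of_TS K (fun x => congrFun hS x) (fun x => congrFun hU x) g x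

/-- A crossed homomorphism is a lift of the action to `X × ℤ` by skew permutations. The norm
relations say exactly that the lifts of `S` and `T * S` have orders dividing 2 and 3, so
`SL2Z_exists_hom` applies. -/
lemma evalGenerators_surjective (hneg : ∀ x : X, (-1 : SL(2, ℤ)) • x = x) :
    Function.Surjective (evalGenerators hneg) := by
  rintro ⟨⟨a, ha⟩, ⟨b, hb⟩⟩
  rw [mem_ker_normS] at ha
  rw [mem_ker_normTS] at hb
  let ρ := MulAction.toPermHom SL(2, ℤ) X
  have hρ : ∀ g x, ρ g x = g • x := fun _ _ => rfl
  have hTS : ∀ x : X, (T * S) • (T * S) • (T * S) • x = x := fun x => by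
    rw [← mul_smul, ← mul_smul, ← pow_two, ← pow_succ, TS_pow_three, hneg]
  obtain ⟨F, hFS, hFU⟩ := SL2Z_exists_hom (skewPerm (ρ S) a) (skewPerm (ρ (T * S)) b)
    (by
      ext1 ⟨x, n⟩
      rw [pow_two, Equiv.Perm.mul_apply, skewPerm_apply, skewPerm_apply, hρ, hρ, ← mul_smul,
        S_mul_S, hneg, add_assoc, ha, add_zero]
      rfl)
    (by
      ext1 ⟨x, n⟩
      rw [pow_succ', pow_two, Equiv.Perm.mul_apply, Equiv.Perm.mul_apply, skewPerm_apply,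
        skewPerm_apply, skewPerm_apply]
      refine Prod.ext (hTS x) ?_
      change n + b x + b ((T * S) • x) + b ((T * S) • (T * S) • x) = n
      have := hb x
      omega)
  -- The elements acting by skew permutations form a subgroup containing both generators; their
  -- translation parts give the cocycle.
  let K : Subgroup SL(2, ℤ) :=
    { carrier := {g | ∃ f : X → ℤ, ∀ x n, F g (x, n) = (g • x, n + f x)}
      mul_mem' := by
        rintro g h ⟨f, hf⟩ ⟨f', hf'⟩
        refine ⟨fun x => f' x + f (h • x), fun x n => ?_⟩
        rw [map_mul, Equiv.Perm.mul_apply, hf', hf, mul_smul, add_assoc]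
      one_mem' := ⟨0, fun x n => by simp⟩
      inv_mem' := by
        rintro g ⟨f, hf⟩
        refine ⟨fun x => - f (g⁻¹ • x), fun x n => ?_⟩
        rw [map_inv, Equiv.Perm.inv_eq_iff_eq, hf]
        simp }
  have hK : ∀ g, ∃ f : X → ℤ, ∀ x n, F g (x, n) = (g • x, n + f x) :=
    SL2Z_mem_of_S_of_TS K ⟨a, fun x n => by rw [hFS]; rfl⟩ ⟨b, fun x n => by rw [hFU]; rfl⟩
  choose f hf using hK
  refine ⟨⟨f, fun g h x => ?_⟩, ?_⟩
  · have h1 := hf (g * h) x 0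
    rw [map_mul, Equiv.Perm.mul_apply, hf h, hf g, Prod.mk.injEq] at h1
    change f (g * h) x = f g (h • x) + f h x
    linarith [h1.2]
  · refine Prod.ext (Subtype.ext ?_) (Subtype.ext ?_)
    · ext x
      have h1 := hf S x 0
      rw [hFS, skewPerm_apply, Prod.mk.injEq] at h1
      change f S x = a x
      omega
    · ext x
      have h1 := hf (T * S) x 0
      rw [hFU, skewPerm_apply, Prod.mk.injEq] at h1
      change f (T * S) x = b x
      omega

/-- Crossed homomorphisms on the modular group are freely determined by their values at the two
generators, subject to the norm relations. -/
noncomputable def funCocyclesEquiv (hneg : ∀ x : X, (-1 : SL(2, ℤ)) • x = x) :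
    funCocycles SL(2, ℤ) X ≃ₗ[ℤ] LinearMap.ker (normS X) × LinearMap.ker (normTS X) :=
  LinearEquiv.ofBijective (evalGenerators hneg)
    ⟨evalGenerators_injective hneg, evalGenerators_surjective hneg⟩

/-- The rank of the group of homomorphisms to `ℤ` from a point stabilizer of the modular group. -/
theorem finrank_hom_stabilizer [Fintype X] [MulAction.IsPretransitive SL(2, ℤ) X]
    (hneg : ∀ x : X, (-1 : SL(2, ℤ)) • x = x) (Γ : Subgroup SL(2, ℤ)) (x₀ : X)
    (hΓ : ∀ g, g ∈ Γ ↔ g • x₀ = x₀) :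
    Module.Finite ℤ (Additive Γ →+ ℤ) ∧
    6 * Module.finrank ℤ (Additive Γ →+ ℤ) + 3 * Nat.card {x : X // S • x = x} +
      4 * Nat.card {x : X // (T * S) • x = x} = Fintype.card X + 6 := by
  have : Module.Finite ℤ (funCocycles SL(2, ℤ) X) := Module.Finite.equiv (funCocyclesEquiv hneg).symm
  refine ⟨Module.Finite.of_surjective _ (funCocyclesRestrict_surjective Γ x₀ hΓ), ?_⟩
  have h := finrank_hom_add_card Γ x₀ hΓ
  rw [(funCocyclesEquiv hneg).finrank_eq, Module.finrank_prod] at h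
  have hn : MulAction.toPermHom SL(2, ℤ) X (-1) = 1 := Equiv.ext hneg
  have h2 := two_mul_finrank_ker_add (MulAction.toPermHom SL(2, ℤ) X S)
    (by rw [← map_pow, pow_two, S_mul_S, hn])
  have h3 := three_mul_finrank_ker_add (MulAction.toPermHom SL(2, ℤ) X (T * S))
    (by rw [← map_pow, TS_pow_three, hn])
  change 2 * Module.finrank ℤ (LinearMap.ker (normS X)) + Nat.card {x : X // S • x = x} = _ at h2
  change 3 * Module.finrank ℤ (LinearMap.ker (normTS X)) +
    2 * Nat.card {x : X // (T * S) • x = x} = _ at h3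
  omega

end Modular

/-! ### The projective line over `ZMod p` and its fixed points. -/

open OnePoint

section ProjectiveLine

variable (p : ℕ) [Fact p.Prime]

/-- The action of the modular group on the projective line over `ZMod p`. -/
abbrev projectiveLineAction : MulAction SL(2, ℤ) (OnePoint (ZMod p)) :=
  MulAction.compHom _ ((toGL).comp (map (n := Fin 2) (Int.castRingHom (ZMod p))))

attribute [local instance] projectiveLineAction

variable {p}

lemma projectiveLine_smul_infty (g : SL(2, ℤ)) :
    g • (∞ : OnePoint (ZMod p)) =
      if (g 1 0 : ZMod p) = 0 then ∞ else (((g 0 0 : ZMod p) / (g 1 0 : ZMod p) : ZMod p)) :=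
  smul_infty_eq_ite _

lemma projectiveLine_smul_coe (g : SL(2, ℤ)) (k : ZMod p) :
    g • (k : OnePoint (ZMod p)) =
      if (g 1 0 : ZMod p) * k + (g 1 1 : ZMod p) = 0 then ∞
      else ((((g 0 0 : ZMod p) * k + (g 0 1 : ZMod p)) /
        ((g 1 0 : ZMod p) * k + (g 1 1 : ZMod p)) : ZMod p)) :=
  smul_some_eq_ite

lemma mem_Gamma0_iff_smul_infty (g : SL(2, ℤ)) :
    g ∈ CongruenceSubgroup.Gamma0 p ↔ g • (∞ : OnePoint (ZMod p)) = ∞ := by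
  rw [CongruenceSubgroup.Gamma0_mem, projectiveLine_smul_infty]
  split_ifs with h <;> simp [h]

lemma projectiveLine_neg_one_smul (x : OnePoint (ZMod p)) : (-1 : SL(2, ℤ)) • x = x := by
  induction x using OnePoint.rec with
  | infty => simp [projectiveLine_smul_infty]
  | coe k => simp [projectiveLine_smul_coe]

lemma projectiveLine_isPretransitive : MulAction.IsPretransitive SL(2, ℤ) (OnePoint (ZMod p)) := by
  refine MulAction.IsPretransitive.of_orbit (x₀ := (∞ : OnePoint (ZMod p))) fun x => ?_
  induction x using OnePoint.rec with
  | infty => exact ⟨1, one_smul _ _⟩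
  | coe k =>
    -- `S` sends `∞` to `0`, and `T ^ k` translates `0` to `k`.
    refine ⟨T ^ (k.val : ℤ) * S, ?_⟩
    rw [projectiveLine_smul_infty, coe_mul, coe_T_zpow]
    simp [S]

lemma S_smul_eq_self_iff (k : ZMod p) : S • (k : OnePoint (ZMod p)) = k ↔ k ^ 2 = -1 := by
  rw [projectiveLine_smul_coe, coe_S]
  by_cases hk : k = 0
  · simp [hk]
  · simp [hk]
    rw [div_eq_iff hk, pow_two, eq_comm]

lemma S_smul_infty_ne : S • (∞ : OnePoint (ZMod p)) ≠ ∞ := by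
  rw [projectiveLine_smul_infty, coe_S]
  simp

lemma coe_TS : ((T * S : SL(2, ℤ)) : Matrix (Fin 2) (Fin 2) ℤ) = !![1, -1; 1, 0] := by
  decide

lemma TS_smul_eq_self_iff (k : ZMod p) :
    (T * S) • (k : OnePoint (ZMod p)) = k ↔ k ^ 2 - k + 1 = 0 := by
  rw [projectiveLine_smul_coe, coe_TS]
  by_cases hk : k = 0
  · simp [hk]
  · simp [hk]
    rw [div_eq_iff hk]
    constructor <;> intro h <;> linear_combination -h

lemma TS_smul_infty_ne : (T * S) • (∞ : OnePoint (ZMod p)) ≠ ∞ := by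
  rw [projectiveLine_smul_infty, coe_TS]
  simp

lemma card_onePoint_subtype {K : Type*} (P : OnePoint K → Prop) (Q : K → Prop) (h : ¬ P ∞)
    (hPQ : ∀ k : K, P k ↔ Q k) : Nat.card {x // P x} = Nat.card {k // Q k} := by
  refine Nat.card_congr (Equiv.ofBijective
    (fun k => ⟨((k : K) : OnePoint K), (hPQ _).2 k.2⟩) ⟨?_, ?_⟩).symm
  · intro a b hab
    exact Subtype.ext (OnePoint.coe_injective (congrArg Subtype.val hab))
  · rintro ⟨x, hx⟩
    induction x using OnePoint.rec with
    | infty => exact absurd hx h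
    | coe k => exact ⟨⟨k, (hPQ k).1 hx⟩, rfl⟩

end ProjectiveLine

/-! ### Counting roots of the fixed-point equations. -/

/-- The equation `k ^ 2 = d` has two or no solutions. -/
lemma card_sq_eq {K : Type*} [Field K] (h2 : (2 : K) ≠ 0) (d : K) (hd : d ≠ 0) :
    (IsSquare d → Nat.card {k : K // k ^ 2 = d} = 2) ∧
      (¬ IsSquare d → Nat.card {k : K // k ^ 2 = d} = 0) := by
  constructor
  · rintro ⟨r, rfl⟩
    have hr : r ≠ 0 := fun h => hd (by simp [h])
    have hne : r ≠ -r := fun h => by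
      have : 2 * r = 0 := by linear_combination h
      exact (mul_ne_zero h2 hr) this
    have : {k : K | k ^ 2 = r * r} = {r, -r} := by
      ext k
      simp [← pow_two, sq_eq_sq_iff_eq_or_eq_neg]
    exact (congrArg Set.ncard this).trans (Set.ncard_pair hne)
  · intro h
    have : IsEmpty {k : K // k ^ 2 = d} := ⟨fun k => h ⟨k.1, k.2.symm.trans (pow_two _)⟩⟩
    exact Nat.card_of_isEmpty

/-- Completing the square. -/
lemma card_sq_sub_add_one_eq {K : Type*} [Field K] (h2 : (2 : K) ≠ 0) :
    Nat.card {k : K // k ^ 2 - k + 1 = 0} = Nat.card {k : K // k ^ 2 = -3} := by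
  refine Nat.card_congr (Equiv.subtypeEquiv
    ((Equiv.mulLeft₀ 2 h2).trans (Equiv.subRight 1)) fun k => ?_)
  change _ ↔ (2 * k - 1) ^ 2 = -3
  have h4 : (4 : K) ≠ 0 := by
    rw [show (4 : K) = 2 * 2 by norm_num]; exact mul_ne_zero h2 h2
  constructor
  · intro h; linear_combination 4 * h
  · intro h
    apply mul_left_cancel₀ h4
    linear_combination h

/-- The sign in quadratic reciprocity for 3 and `p` cancels the symbol of `-1`, leaving the symbol
of `p` modulo 3. -/
lemma isSquare_neg_three_iff (p : ℕ) [Fact p.Prime] (hp3 : 3 < p) :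
    IsSquare (-3 : ZMod p) ↔ p % 3 = 1 := by
  have h0 : ((-3 : ℤ) : ZMod p) ≠ 0 := fun h => by
    have := Int.le_of_dvd three_pos ((dvd_neg (b := 3)).1 ((ZMod.intCast_zmod_eq_zero_iff_dvd _ p).1 h))
    omega
  have hodd : p % 2 = 1 := (Nat.Prime.eq_two_or_odd Fact.out).resolve_left (by omega)
  have h1 : legendreSym p (-3) = legendreSym 3 p := by
    have hr : legendreSym p 3 = (-1) ^ (3 / 2 * (p / 2)) * legendreSym 3 p :=
      legendreSym.quadratic_reciprocity' (by norm_num) (by omega)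
    rw [show (-3 : ℤ) = -1 * 3 by norm_num, legendreSym.mul, legendreSym.at_neg_one (by omega), hr,
      ZMod.χ₄_eq_neg_one_pow hodd, ← mul_assoc, ← pow_add]
    norm_num [← two_mul]
  have h3 : ¬ 3 ∣ p := (Nat.prime_dvd_prime_iff_eq Nat.prime_three Fact.out).not.2 (by omega)
  have h4 : ((p : ℤ) : ZMod 3) = ((p % 3 : ℕ) : ZMod 3) := by simp
  have h5 := legendreSym.eq_one_iff p h0
  rw [h1, legendreSym, h4] at h5
  push_cast at h5
  rw [← h5]
  have : p % 3 = 1 ∨ p % 3 = 2 := by omega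
  rcases this with h | h <;> simp only [h] <;> decide

/-! ### The rank by residue of `p` modulo 12. -/

theorem proposition2p2 (p : ℕ) (hp : p.Prime) (hp3 : 3 < p) :
    Nonempty (groupCohomology (Rep.trivial ℤ (CongruenceSubgroup.Gamma0 p) ℤ) 1 ≃ₗ[ℤ]
      (Fin (rankN p) → ℤ)) := by
  have : Fact p.Prime := ⟨hp⟩
  let _ := projectiveLineAction p
  have := projectiveLine_isPretransitive (p := p)
  let _ : Fintype (OnePoint (ZMod p)) := inferInstanceAs (Fintype (Option (ZMod p)))
  have hcard : Fintype.card (OnePoint (ZMod p)) = p + 1 := by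
    rw [← Nat.card_eq_fintype_card]
    change Nat.card (Option (ZMod p)) = _
    rw [Finite.card_option, Nat.card_zmod]
  obtain ⟨hfin, hrank⟩ := finrank_hom_stabilizer projectiveLine_neg_one_smul
    (CongruenceSubgroup.Gamma0 p) (∞ : OnePoint (ZMod p)) mem_Gamma0_iff_smul_infty
  have h2 : (2 : ZMod p) ≠ 0 := fun h => by
    have := Nat.le_of_dvd two_pos ((ZMod.natCast_eq_zero_iff 2 p).1 (by exact_mod_cast h))
    omega
  have h3 : (3 : ZMod p) ≠ 0 := fun h => by
    have := Nat.le_of_dvd three_pos ((ZMod.natCast_eq_zero_iff 3 p).1 (by exact_mod_cast h))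
    omega
  rw [hcard, card_onePoint_subtype (fun x => S • x = x) _ S_smul_infty_ne S_smul_eq_self_iff,
    card_onePoint_subtype (fun x => (T * S) • x = x) _ TS_smul_infty_ne TS_smul_eq_self_iff,
    card_sq_sub_add_one_eq h2] at hrank
  have hS := card_sq_eq h2 (-1 : ZMod p) (neg_ne_zero.2 one_ne_zero)
  have hT := card_sq_eq h2 (-3 : ZMod p) (neg_ne_zero.2 h3)
  rw [ZMod.exists_sq_eq_neg_one_iff] at hS
  rw [isSquare_neg_three_iff p hp3] at hT
  have hp2' : p % 2 ≠ 0 := fun h => by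
    have := (Nat.prime_dvd_prime_iff_eq Nat.prime_two hp).1 (Nat.dvd_of_mod_eq_zero h)
    omega
  have hp3' : p % 3 ≠ 0 := fun h => by
    have := (Nat.prime_dvd_prime_iff_eq Nat.prime_three hp).1 (Nat.dvd_of_mod_eq_zero h)
    omega
  -- Ensures that `p - 7` in `rankN` does not truncate.
  have hp7 : p % 12 = 1 → 13 ≤ p := by omega
  have hN : Module.finrank ℤ (Additive (CongruenceSubgroup.Gamma0 p) →+ ℤ) = rankN p := by
    unfold rankN
    split_ifs <;> omega
  have hfree : Module.Free ℤ (Additive (CongruenceSubgroup.Gamma0 p) →+ ℤ) := by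
    have : Module.IsTorsionFree ℤ (Additive (CongruenceSubgroup.Gamma0 p) →+ ℤ) :=
      Function.Injective.moduleIsTorsionFree (DFunLike.coe : _ → _ → ℤ) DFunLike.coe_injective
        fun _ _ => rfl
    infer_instance
  let e := (groupCohomology.H1IsoOfIsTrivial
    (Rep.trivial ℤ (CongruenceSubgroup.Gamma0 p) ℤ)).toLinearEquiv
  exact ⟨e.trans ((Module.finBasisOfFinrankEq ℤ _ hN).equivFun)⟩
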